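/- **Setting.** Let $e_n(x)=\pi^{-1/4}((n-1)!)^{-1/2}\,h_{n-1}(\sqrt2\,x)\,e^{-x^2/2}$, $n\ge 1$, be the Hermite functions ($h_k$ the probabilists' Hermite polynomials), an orthonormal basis of the complex space $\mathcal K_0=\mathbf L_2(\mathbb R,dx)$. For $p\in\mathbb Z$ let $$\mathcal K_p=\Big\{\sum_{n\ge1} f_ne_n:\ \sum_{n\ge 1}|f_n|^2\,2^{np}<\infty\Big\},$$ and let $\Gamma(\mathcal K_p)=\bigoplus_{k\ge0}\mathcal K_p^{\otimes k}$ be its full Fock space, i.e. the space of formal series $u=\sum_\alpha u_\alpha e_\alpha$ over words $\alpha=(n_1,\dots,n_k)$, $k\ge 0$, where $e_\alpha=e_{n_1}\otimes\cdots\otimes e_{n_k}$, with $\sum_\alpha |u_\alpha|^2\,2^{(n_1+\cdots+n_k)p}<\infty$. Put $$\widetilde{\mathcal G}_1=\bigcap_{p\in\mathbb N}\Gamma(\mathcal K_p)\ \subset\ \Gamma(\mathcal K_0)\ \subset\ \widetilde{\mathcal G}_{-1}=\bigcup_{p\in\mathbb N}\Gamma(\mathcal K_{-p}),$$ with the projective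 limit topology on $\widetilde{\mathcal G}_1$ and the locally convex inductive limit topology on $\widetilde{\mathcal G}_{-1}$ (which is its strong topology as the dual of $\widetilde{\mathcal G}_1$); $\mathcal L(\widetilde{\mathcal G}_1,\widetilde{\mathcal G}_{-1})$ is the space of continuous linear maps. For $h\in\bigcup_p\mathcal K_{-p}$ let $\ell_hu=h\otimes u$ and let $\ell_h^*$ be its adjoint, so that $\ell_h^*(k\otimes u)=\langle h,k\rangle u$ and $\ell_h^*$ vanishes on the vacuum (the inner product is conjugate-linear in its first argument). Write $\widehat f(u)=\int_{\mathbb R}e^{-iux}f(x)\,dx$, and $1_{[0,t]}=-1_{[t,0]}$ for $t<0$. For a measurable $m:\mathbb R\to[0,\infty)$ the operator $T_m$ is given by $\widehat{T_mf}=\sqrt m\,\widehat f$; the generalized function $T_m1_{[0,t]}$ is $\sum_n\alpha_n(t)e_n$ with $$\alpha_n(t)=\frac1{2\pi}\int_{\mathbb R}\sqrt{m(u)}\ \widehat{1_{[0,t]}}(u)\,\overline{\widehat{e_n}(u)}\,du .$$ **Theorem.** Assume that there are real numbers $b<2$, $K$, $C_1>0$, $C_2>0$ such that $$m(t)\le K|t|^{-b}\quad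 (0<|t|\le 1),\qquad m(t)\le C_1e^{C_2|t|}\quad(|t|\ge1).$$ Then: 1. For all $t\in\mathbb R$ and $n\ge 1$ the integral defining $\alpha_n(t)$ converges absolutely, and for every $t\in\mathbb R$ there is $p\in\mathbb N$ with $T_m1_{[0,t]}\in\mathcal K_{-p}$. 2. If moreover $\int_{\mathbb R}\frac{m(u)}{1+u^2}\,du<\infty$, then for every $t$ the function $1_{[0,t]}$ is in the domain of the operator $T_m$ of $\mathbf L_2(\mathbb R,dx)$, and the $\alpha_n(t)$ are the Hermite coefficients $\langle e_n,T_m1_{[0,t]}\rangle$ of its value in $\mathbf L_2(\mathbb R,dx)$. 3. For every $t\in\mathbb R$, $X_m(t)=\ell_{T_m1_{[0,t]}}+\ell^*_{T_m1_{[0,t]}}$ belongs to $\mathcal L(\widetilde{\mathcal G}_1,\widetilde{\mathcal G}_{-1})$, and there is an $\mathcal L(\widetilde{\mathcal G}_1,\widetilde{\mathcal G}_{-1})$-valued function $t\mapsto W_m(t)$ on $\mathbb R$ such that $$\frac{d}{dt}X_m(t)f=W_m(t)f\qquad\text{for all } t\in\mathbb R \text{ and } f\in\widetilde{\mathcal G}_1,$$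 the derivative being taken in the topology of $\widetilde{\mathcal G}_{-1}$. -/

import Mathlib

open MeasureTheory Filter Topology
open scoped NNReal ENNReal FourierTransform ComplexConjugate

noncomputable section

namespace FreeNoise

/-! ### Weighted `ℓ²` spaces -/

/-- The space `ℓ²(ι, w)` of complex families `u` with `∑ i, w i * |u i|² < ∞`. -/
def weightedL2 {ι : Type} (w : ι → ℝ≥0) : Submodule ℂ (ι → ℂ) where
  carrier := {u | Summable fun i => (w i : ℝ) * ‖u i‖ ^ 2}
  zero_mem' := by simp
  add_mem' := by
    intro a b ha hb
    refine Summable.of_nonneg_of_le (fun i => by positivity) (fun i => ?_)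
      ((ha.mul_left 2).add (hb.mul_left 2))
    have h1 : ‖a i + b i‖ ≤ ‖a i‖ + ‖b i‖ := norm_add_le _ _
    have h2 : ‖a i + b i‖ ^ 2 ≤ 2 * ‖a i‖ ^ 2 + 2 * ‖b i‖ ^ 2 := by
      nlinarith [norm_nonneg (a i + b i), sq_nonneg (‖a i‖ - ‖b i‖)]
    have h3 := mul_le_mul_of_nonneg_left h2 (w i).coe_nonneg
    simp only [Pi.add_apply]
    linarith
  smul_mem' := by
    intro c a ha
    refine (ha.mul_left (‖c‖ ^ 2)).congr (fun i => ?_)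
    simp only [Pi.smul_apply, smul_eq_mul, norm_mul]
    ring

theorem mem_weightedL2 {ι : Type} {w : ι → ℝ≥0} {u : ι → ℂ} :
    u ∈ weightedL2 w ↔ Summable fun i => (w i : ℝ) * ‖u i‖ ^ 2 := Iff.rfl

theorem memlp_sqrt_mul {ι : Type} {w : ι → ℝ≥0} {u : ι → ℂ} (hu : u ∈ weightedL2 w) :
    Memℓp (fun i => ((Real.sqrt (w i) : ℝ) : ℂ) * u i) 2 := by
  refine memℓp_gen ?_
  refine (mem_weightedL2.1 hu).congr (fun i => ?_)
  simp [mul_pow, Real.sq_sqrt]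

/-- The isometry `u ↦ (√(w i) * u i)` of `ℓ²(ι, w)` into the unweighted `ℓ²(ι)`. -/
def toLp2 {ι : Type} (w : ι → ℝ≥0) : weightedL2 w →ₗ[ℂ] lp (fun _ : ι => ℂ) 2 where
  toFun u := ⟨fun i => ((Real.sqrt (w i) : ℝ) : ℂ) * (u : ι → ℂ) i, memlp_sqrt_mul u.2⟩
  map_add' u v := by
    ext i
    exact mul_add _ _ _
  map_smul' c u := by
    ext i
    simp [mul_left_comm]

/-! ### The scale `K_p`, the full Fock spaces `Γ(K_p)` and the triple `G̃₁ ⊆ Γ(K_0) ⊆ G̃₋₁`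

Basis vectors are indexed from `0`: the index `n : ℕ` stands for `e_{n+1}`, whose weight is
`a_{n+1} = 2 ^ (n + 1)`.  A word `[n₁, …, n_k]` stands for the basis vector
`e_{n₁+1} ⊗ ⋯ ⊗ e_{n_k+1}` of the `k`-th tensor power, the empty word for the vacuum `Ω`. -/

/-- The weight `a_{n+1} = 2 ^ (n + 1)`. -/
def letterWeight (n : ℕ) : ℝ≥0 := 2 ^ (n + 1)

/-- `K_p = {∑ f_n e_n : ∑ |f_n|² a_n ^ p < ∞}`, as a space of coefficient sequences. -/
def K (p : ℤ) : Submodule ℂ (ℕ → ℂ) := weightedL2 fun n => letterWeight n ^ p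

/-- The weight of `e_{n₁+1} ⊗ ⋯ ⊗ e_{n_k+1}` in `Γ(K_p)`, namely the product of the weights of
the factors. -/
def wordWeight (p : ℤ) (α : List ℕ) : ℝ≥0 := (α.map fun n => letterWeight n ^ p).prod

theorem wordWeight_pos (p : ℤ) (α : List ℕ) : 0 < wordWeight p α := by
  induction α with
  | nil => simp [wordWeight]
  | cons n α ih =>
    have : wordWeight p (n :: α) = letterWeight n ^ p * wordWeight p α := by simp [wordWeight]
    rw [this]
    have : 0 < letterWeight n := by unfold letterWeight; positivity
    positivity

theorem wordWeight_mono {p q : ℤ} (h : p ≤ q) (α : List ℕ) :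
    wordWeight p α ≤ wordWeight q α := by
  induction α with
  | nil => simp [wordWeight]
  | cons n α ih =>
    have e (r : ℤ) : wordWeight r (n :: α) = letterWeight n ^ r * wordWeight r α := by
      simp [wordWeight]
    rw [e, e]
    have h1 : 1 ≤ letterWeight n := one_le_pow₀ one_le_two
    exact mul_le_mul' (zpow_le_zpow_right₀ h1 h) ih

/-- The full Fock space `Γ(K_p) = ⊕ₖ K_p^{⊗k}` in coordinates: all families `u` indexed by words
with `∑ α, wordWeight p α * |u α|² < ∞`. -/
def fockSubmodule (p : ℤ) : Submodule ℂ (List ℕ → ℂ) := weightedL2 (wordWeight p)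

theorem fockSubmodule_anti {p q : ℤ} (h : p ≤ q) : fockSubmodule q ≤ fockSubmodule p := by
  intro u hu
  refine Summable.of_nonneg_of_le (fun α => by positivity) (fun α => ?_) (mem_weightedL2.1 hu)
  have := wordWeight_mono h α
  gcongr

/-- The Fock space `Γ(K_p)` as a normed space (with norm given in `Fock.norm_sq`). -/
def Fock (p : ℤ) : Type := fockSubmodule p

namespace Fock

instance (p : ℤ) : AddCommGroup (Fock p) := inferInstanceAs (AddCommGroup (fockSubmodule p))

instance (p : ℤ) : Module ℂ (Fock p) := inferInstanceAs (Module ℂ (fockSubmodule p))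

/-- The isometry of `Γ(K_p)` into the unweighted `ℓ²` space over words. -/
def toLp (p : ℤ) : Fock p →ₗ[ℂ] lp (fun _ : List ℕ => ℂ) 2 := toLp2 (wordWeight p)

theorem toLp_injective (p : ℤ) : Function.Injective (toLp p) := by
  intro u v h
  refine Subtype.ext (funext fun α => ?_)
  have h1 := congrFun (congrArg Subtype.val h) α
  have h2 : ((Real.sqrt (wordWeight p α) : ℝ) : ℂ) ≠ 0 := by
    have : 0 < (wordWeight p α : ℝ) := wordWeight_pos p α
    exact_mod_cast (Real.sqrt_pos.2 this).ne'
  exact mul_left_cancel₀ h2 h1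

instance (p : ℤ) : NormedAddCommGroup (Fock p) :=
  NormedAddCommGroup.induced _ _ (toLp p) (toLp_injective p)

instance (p : ℤ) : NormedSpace ℂ (Fock p) := NormedSpace.induced _ _ _ (toLp p)

theorem norm_sq (p : ℤ) (u : Fock p) :
    ‖u‖ ^ 2 = ∑' α, (wordWeight p α : ℝ) * ‖u.1 α‖ ^ 2 := by
  have h : ‖u‖ = ‖toLp p u‖ := rfl
  have h2 := lp.norm_rpow_eq_tsum (p := 2) (by norm_num) (toLp p u)
  rw [h]
  simp only [ENNReal.toReal_ofNat, Real.rpow_ofNat] at h2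
  rw [h2]
  refine tsum_congr fun α => ?_
  have h3 : (toLp p u) α = ((Real.sqrt (wordWeight p α) : ℝ) : ℂ) * u.1 α := rfl
  rw [h3, norm_mul, mul_pow]
  simp [Real.sq_sqrt]

end Fock

/-- The test space `G̃₁ = ⋂_{p ∈ ℕ} Γ(K_p)`. -/
def G1 : Type := (⨅ p : ℕ, fockSubmodule p : Submodule ℂ (List ℕ → ℂ))

namespace G1

instance : AddCommGroup G1 :=
  inferInstanceAs (AddCommGroup (⨅ p : ℕ, fockSubmodule p : Submodule ℂ (List ℕ → ℂ)))

instance : Module ℂ G1 :=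
  inferInstanceAs (Module ℂ (⨅ p : ℕ, fockSubmodule p : Submodule ℂ (List ℕ → ℂ)))

/-- The coordinates of an element of `G̃₁`. -/
def coeff (f : G1) : List ℕ → ℂ := f.1

/-- The inclusion `G̃₁ ⊆ Γ(K_p)`. -/
def toFock (p : ℕ) : G1 →ₗ[ℂ] Fock p :=
  Submodule.inclusion (iInf_le (fun p : ℕ => fockSubmodule p) p)

/-- The projective limit (Fréchet) topology: the coarsest one that makes all the inclusions
`G̃₁ ⊆ Γ(K_p)` continuous. -/
instance : TopologicalSpace G1 :=
  ⨅ p : ℕ, TopologicalSpace.induced (toFock p) inferInstance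

end G1

/-- The distribution space `G̃₋₁ = ⋃_{p ∈ ℕ} Γ(K_{-p})`, as a submodule. -/
def gm1Submodule : Submodule ℂ (List ℕ → ℂ) where
  carrier := {u | ∃ p : ℕ, u ∈ fockSubmodule (-(p : ℤ))}
  zero_mem' := ⟨0, Submodule.zero_mem _⟩
  add_mem' := by
    rintro a b ⟨p, hp⟩ ⟨q, hq⟩
    refine ⟨max p q, Submodule.add_mem _ (fockSubmodule_anti ?_ hp) (fockSubmodule_anti ?_ hq)⟩
    · have := le_max_left p q
      omega
    · have := le_max_right p q
      omega
  smul_mem' := by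
    rintro c a ⟨p, hp⟩
    exact ⟨p, Submodule.smul_mem _ c hp⟩

/-- The distribution space `G̃₋₁ = ⋃_{p ∈ ℕ} Γ(K_{-p})`. -/
def Gm1 : Type := gm1Submodule

namespace Gm1

instance : AddCommGroup Gm1 := inferInstanceAs (AddCommGroup gm1Submodule)

instance : Module ℂ Gm1 := inferInstanceAs (Module ℂ gm1Submodule)

/-- The coordinates of an element of `G̃₋₁`. -/
def coeff (F : Gm1) : List ℕ → ℂ := F.1

/-- The inclusion `Γ(K_{-p}) ⊆ G̃₋₁`. -/
def ofFock (p : ℕ) : Fock (-(p : ℤ)) →ₗ[ℂ] Gm1 :=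
  Submodule.inclusion (show fockSubmodule (-(p : ℤ)) ≤ gm1Submodule from fun _ hu => ⟨p, hu⟩)

/-- The vector space topologies on `G̃₋₁` that are locally convex and make all the inclusions
`Γ(K_{-p}) ⊆ G̃₋₁` continuous. -/
def admissibleTopologies : Set (TopologicalSpace Gm1) :=
  {t | @IsTopologicalAddGroup Gm1 t _ ∧ @ContinuousSMul ℂ Gm1 _ _ t ∧
    @LocallyConvexSpace ℝ Gm1 _ _ _ _ t ∧ ∀ p : ℕ, @Continuous _ _ _ t (ofFock p)}

/-- The locally convex inductive limit topology of `G̃₋₁ = ⋃_p Γ(K_{-p})`: the finest locally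
convex topology that makes all the inclusions continuous.  The embeddings
`Γ(K_{-p}) ⊆ Γ(K_{-q})` being Hilbert-Schmidt for large `q - p`, it is also the strong topology
of `G̃₋₁` as the dual of `G̃₁`. -/
instance : TopologicalSpace Gm1 := sInf admissibleTopologies

instance : IsTopologicalAddGroup Gm1 := topologicalAddGroup_sInf fun _ ht => ht.1

instance : ContinuousSMul ℂ Gm1 := continuousSMul_sInf fun _ ht => ht.2.1

instance : LocallyConvexSpace ℝ Gm1 := .sInf fun _ ht => ht.2.2.1

theorem continuous_ofFock (p : ℕ) : Continuous (ofFock p) :=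
  continuous_sInf_rng.2 fun _ ht => ht.2.2.2 p

end Gm1

/-! ### Creation and annihilation operators -/

/-- The creation operator `ℓ_h u = h ⊗ u`, in coordinates. -/
def creation (h : ℕ → ℂ) (u : List ℕ → ℂ) : List ℕ → ℂ
  | [] => 0
  | n :: α => h n * u α

/-- The annihilation operator `ℓ_h^*`, given by `ℓ_h^* (k ⊗ u) = ⟨h, k⟩ u` and `ℓ_h^* Ω = 0`, in
coordinates.  It is the adjoint of `creation h`, see `annihilation_adjoint`. -/
def annihilation (h : ℕ → ℂ) (u : List ℕ → ℂ) : List ℕ → ℂ :=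
  fun α => ∑' n, conj (h n) * u (n :: α)

/-- The operator `X_h = ℓ_h + ℓ_h^*`. -/
def freeField (h : ℕ → ℂ) (u : List ℕ → ℂ) : List ℕ → ℂ :=
  creation h u + annihilation h u

/-- For `h ∈ K_{-q}`, `v ∈ Γ(K_{-q})` and `u ∈ Γ(K_q)` one has `⟨ℓ_h v, u⟩ = ⟨v, ℓ_h^* u⟩`, in the
pairing of `Γ(K_{-q})` and `Γ(K_q)` that extends the inner product of `Γ(K_0)`. -/
theorem annihilation_adjoint {q : ℤ} {h : ℕ → ℂ} {u v : List ℕ → ℂ} (hh : h ∈ K (-q))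
    (hv : v ∈ fockSubmodule (-q)) (hu : u ∈ fockSubmodule q) :
    ∑' α, conj (creation h v α) * u α = ∑' α, conj (v α) * annihilation h u α := by
  have hinj : Function.Injective fun x : List ℕ × ℕ => x.2 :: x.1 := by
    rintro ⟨α, n⟩ ⟨β, k⟩ hx
    simp only [List.cons.injEq] at hx
    exact Prod.ext hx.2 hx.1
  have e1 : ∑' α, conj (creation h v α) * u α =
      ∑' x : List ℕ × ℕ, conj (v x.1) * (conj (h x.2) * u (x.2 :: x.1)) := by
    rw [← hinj.tsum_eq]
    · refine tsum_congr fun x => ?_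
      simp only [creation, map_mul]
      ring
    · intro α hα
      cases α with
      | nil => simp [creation] at hα
      | cons n α => exact ⟨(α, n), rfl⟩
  have hs : Summable fun x : List ℕ × ℕ => conj (v x.1) * (conj (h x.2) * u (x.2 :: x.1)) := by
    have s1 := (mem_weightedL2.1 hv).mul_of_nonneg (mem_weightedL2.1 hh)
      (fun α => by positivity) (fun n => by positivity)
    have s2 := (mem_weightedL2.1 hu).comp_injective hinj
    refine Summable.of_norm_bounded (s1.add s2) fun x => ?_
    obtain ⟨α, n⟩ := x
    have hA : 0 < (wordWeight (-q) α : ℝ) := wordWeight_pos _ _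
    have hN0 : 0 < letterWeight n := by unfold letterWeight; positivity
    have hN : 0 < ((letterWeight n ^ (-q) : ℝ≥0) : ℝ) := by
      have : 0 < letterWeight n ^ (-q) := zpow_pos hN0 _
      exact_mod_cast this
    have hinv (β : List ℕ) : (wordWeight q β : ℝ) = ((wordWeight (-q) β : ℝ))⁻¹ := by
      induction β with
      | nil => simp [wordWeight]
      | cons k β ih =>
        have e (r : ℤ) : wordWeight r (k :: β) = letterWeight k ^ r * wordWeight r β := by
          simp [wordWeight]
        rw [e, e, NNReal.coe_mul, ih]
        push_cast
        rw [mul_inv, zpow_neg, inv_inv]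
    have ec : (wordWeight (-q) (n :: α) : ℝ) =
        ((letterWeight n ^ (-q) : ℝ≥0) : ℝ) * (wordWeight (-q) α : ℝ) := by
      simp [wordWeight]
    simp only [Function.comp_apply, hinv, ec, norm_mul, RCLike.norm_conj]
    generalize ((letterWeight n ^ (-q) : ℝ≥0) : ℝ) = N at hN
    generalize (wordWeight (-q) α : ℝ) = A at hA
    have hNA : 0 < N * A := mul_pos hN hA
    have key : A * ‖v α‖ ^ 2 * (N * ‖h n‖ ^ 2) + (N * A)⁻¹ * ‖u (n :: α)‖ ^ 2 -
        ‖v α‖ * (‖h n‖ * ‖u (n :: α)‖) = (N * A)⁻¹ *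
          (((N * A) * (‖v α‖ * ‖h n‖) - ‖u (n :: α)‖ / 2) ^ 2 + 3 / 4 * ‖u (n :: α)‖ ^ 2) := by
      field_simp
      ring
    have : 0 ≤ (N * A)⁻¹ *
          (((N * A) * (‖v α‖ * ‖h n‖) - ‖u (n :: α)‖ / 2) ^ 2 + 3 / 4 * ‖u (n :: α)‖ ^ 2) := by
      positivity
    linarith
  rw [e1, hs.tsum_prod]
  refine tsum_congr fun α => ?_
  simp only [annihilation]
  exact tsum_mul_left

/-! ### Hermite functions, the Fourier transform and `T_m 1_{[0,t]}` -/

/-- The Hermite function `e_{n+1}(x) = h_n(√2 x) e^{-x²/2} / (π^{1/4} √(n!))`, where `h_n` is the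
`n`-th (probabilists') Hermite polynomial.  These functions are the orthonormal basis of
`K_0 = L²(ℝ, dx)` that is used throughout. -/
def hermiteFun (n : ℕ) (x : ℝ) : ℂ :=
  ((Polynomial.aeval (Real.sqrt 2 * x) (Polynomial.hermite n) * Real.exp (-x ^ 2 / 2) /
    (Real.pi ^ (1 / 4 : ℝ) * Real.sqrt (n.factorial)) : ℝ) : ℂ)

/-- The Fourier transform `f̂(u) = ∫ e^{-iux} f(x) dx` of an integrable function. -/
def ft (f : ℝ → ℂ) (u : ℝ) : ℂ := ∫ x : ℝ, Complex.exp (-(Complex.I * u * x)) * f x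

/-- The function `1_{[0,t]}`, understood as `-1_{[t,0]}` for `t < 0`. -/
def indicatorTo (t : ℝ) : ℝ → ℂ :=
  if 0 ≤ t then (Set.Icc 0 t).indicator 1 else -(Set.Icc t 0).indicator 1

/-- The relation `T_m f = g` in `L²(ℝ, dx)`: `f` is in the domain of `T_m` and
`ĝ(u) = √(m(u)) f̂(u)` for almost every `u`.  Mathlib's (unitary) transform `𝓕` satisfies
`f̂(2πξ) = (𝓕 f)(ξ)`. -/
def IsTm (m : ℝ → ℝ) (f g : Lp ℂ 2 (volume : Measure ℝ)) : Prop :=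
  ∀ᵐ ξ : ℝ, (𝓕 g : Lp ℂ 2 (volume : Measure ℝ)) ξ =
    (Real.sqrt (m (2 * Real.pi * ξ)) : ℂ) * (𝓕 f : Lp ℂ 2 (volume : Measure ℝ)) ξ

/-- The function `√(m(u)) (1_{[0,t]})^(u) conj(ê_{n+1}(u))`. -/
def tmDensity (m : ℝ → ℝ) (t : ℝ) (n : ℕ) (u : ℝ) : ℂ :=
  (Real.sqrt (m u) : ℂ) * ft (indicatorTo t) u * conj (ft (hermiteFun n) u)

/-- The Hermite coefficients `⟨e_{n+1}, T_m 1_{[0,t]}⟩` of the generalized function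
`T_m 1_{[0,t]}`, whose Fourier transform is `√m (1_{[0,t]})^`, computed by Plancherel's formula. -/
def tmIndicator (m : ℝ → ℝ) (t : ℝ) (n : ℕ) : ℂ :=
  (1 / (2 * Real.pi) : ℂ) * ∫ u : ℝ, tmDensity m t n u

end FreeNoise

end

/-! By the three-term recurrence `|h_n(y)| ≤ (|y| + √n)^n`, so for every `a < 1/2` there is `A` with
`|e_{n+1}(x)| ≤ A ^ n e^{-a x²}`.  As the `e_n` are eigenfunctions of the Fourier transform, a
generalized function whose Fourier transform has norm `N` in `L¹(e^{-a u²} du)` has Hermite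
coefficients bounded by `N A ^ n`, and lies in `K_{-p}` with norm at most `2 N`, where `p` depends
only on `a`.

The difference quotients of `t ↦ (1_{[0,t]})^(u)` converge to `e^{-iut}` and are bounded by `1`.
If `√m ∈ L¹(e^{-a u²} du)`, dominated convergence makes `t ↦ T_m 1_{[0,t]}` differentiable in
`K_{-p}`, and `h ↦ ℓ_h + ℓ_h^*` is real-linear and bounded from `K_{-p}` to the operators
`Γ(K_p) → Γ(K_{-p})`.
-/

noncomputable section

namespace FreeNoise

/-! ### Growth of the Hermite functions -/

section HermiteBound

open Polynomial

theorem derivative_hermite_succ (n : ℕ) :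
    derivative (hermite (n + 1)) = ((n + 1 : ℕ) : ℤ[X]) * hermite n := by
  induction n with
  | zero => simp
  | succ n ih =>
    rw [hermite_succ (n + 1), ih]
    simp only [derivative_sub, derivative_mul, derivative_X, ih, derivative_natCast]
    rw [hermite_succ n]
    push_cast
    ring

theorem aeval_hermite_add_two {R : Type*} [CommRing R] (n : ℕ) (y : R) :
    aeval y (hermite (n + 2)) =
      y * aeval y (hermite (n + 1)) - (n + 1) * aeval y (hermite n) := by
  rw [hermite_succ (n + 1), derivative_hermite_succ]
  simp

theorem abs_aeval_hermite_le {n : ℕ} {s : ℝ} (hs : 0 ≤ s) (hn : n ≤ s ^ 2) (y : ℝ) :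
    |aeval y (hermite n)| ≤ (|y| + s) ^ n := by
  induction n using Nat.twoStepInduction with
  | zero => simp
  | one => simpa
  | more n ih₀ ih₁ =>
    push_cast at hn ih₁
    calc |aeval y (hermite (n + 2))|
        ≤ |y| * |aeval y (hermite (n + 1))| + (n + 1) * |aeval y (hermite n)| := by
          rw [aeval_hermite_add_two]
          refine (abs_sub _ _).trans_eq ?_
          rw [abs_mul, abs_mul, abs_of_nonneg (by positivity : (0 : ℝ) ≤ n + 1)]
      _ ≤ |y| * (|y| + s) ^ (n + 1) + s ^ 2 * (|y| + s) ^ n := by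
          gcongr
          · exact ih₁ (by linarith)
          · linarith
          · exact ih₀ (by linarith)
      _ = (|y| ^ 2 + |y| * s + s ^ 2) * (|y| + s) ^ n := by ring
      _ ≤ (|y| + s) ^ 2 * (|y| + s) ^ n := by
          gcongr
          nlinarith [mul_nonneg (abs_nonneg y) hs]
      _ = (|y| + s) ^ (n + 2) := by ring

theorem sq_aeval_hermite_le {c : ℝ} (hc : 0 < c) (n : ℕ) (y : ℝ) :
    aeval y (hermite n) ^ 2 ≤ n.factorial * (2 / c * Real.exp c) ^ n * Real.exp (c * y ^ 2) := by
  have hn : √(n : ℝ) ^ 2 = n := Real.sq_sqrt n.cast_nonneg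
  have hexp := Real.pow_div_factorial_le_exp (x := c * (y ^ 2 + n)) (by positivity) n
  rw [div_le_iff₀ (by positivity)] at hexp
  calc aeval y (hermite n) ^ 2
      = |aeval y (hermite n)| ^ 2 := (sq_abs _).symm
    _ ≤ ((|y| + √n) ^ n) ^ 2 := by
        gcongr
        exact abs_aeval_hermite_le (Real.sqrt_nonneg _) hn.ge y
    _ = ((|y| + √n) ^ 2) ^ n := pow_right_comm _ _ _
    _ ≤ (2 * (y ^ 2 + n)) ^ n := by
        gcongr
        simpa only [sq_abs, hn] using add_sq_le (a := |y|) (b := √n)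
    _ = (2 / c) ^ n * (c * (y ^ 2 + n)) ^ n := by
        rw [← mul_pow]
        field_simp
    _ ≤ (2 / c) ^ n * (Real.exp (c * (y ^ 2 + n)) * n.factorial) := by gcongr
    _ = n.factorial * (2 / c * Real.exp c) ^ n * Real.exp (c * y ^ 2) := by
        rw [mul_pow, ← Real.exp_nat_mul, mul_add, Real.exp_add, mul_comm c n]
        ring

theorem exists_norm_hermiteFun_le {a : ℝ} (ha : a < 1 / 2) :
    ∃ A : ℝ, ∀ n x, ‖hermiteFun n x‖ ≤ A ^ n * Real.exp (-a * x ^ 2) := by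
  have hc : 0 < 1 / 2 - a := sub_pos.2 ha
  set B := 2 / (1 / 2 - a) * Real.exp (1 / 2 - a)
  have hB : 0 ≤ B := by positivity
  refine ⟨√B, fun n x => le_of_sq_le_sq ?_ (by positivity)⟩
  have hpi : 1 ≤ (Real.pi ^ (1 / 4 : ℝ)) ^ 2 :=
    one_le_pow₀ (Real.one_le_rpow (by linarith [Real.pi_gt_three]) (by norm_num))
  have hfac : (0 : ℝ) < n.factorial := by positivity
  calc ‖hermiteFun n x‖ ^ 2
      = aeval (√2 * x) (hermite n) ^ 2 * Real.exp (-x ^ 2) /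
          ((Real.pi ^ (1 / 4 : ℝ)) ^ 2 * n.factorial) := by
        rw [hermiteFun, Complex.norm_real, Real.norm_eq_abs, sq_abs, div_pow, mul_pow, mul_pow,
          Real.sq_sqrt hfac.le, ← Real.exp_nat_mul]
        congr 3
        push_cast
        ring
    _ ≤ n.factorial * B ^ n * Real.exp ((1 / 2 - a) * (√2 * x) ^ 2) * Real.exp (-x ^ 2) /
          (1 * n.factorial) := by
        gcongr
        exact sq_aeval_hermite_le hc n _
    _ = B ^ n * (Real.exp ((1 / 2 - a) * (√2 * x) ^ 2) * Real.exp (-x ^ 2)) := by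
        field_simp
    _ = B ^ n * Real.exp (-a * x ^ 2) ^ 2 := by
        rw [← Real.exp_add, ← Real.exp_nat_mul, mul_pow √2, Real.sq_sqrt zero_le_two]
        congr 2
        push_cast
        ring
    _ = (√B ^ n * Real.exp (-a * x ^ 2)) ^ 2 := by
        rw [mul_pow (√B ^ n), pow_right_comm, Real.sq_sqrt hB]

end HermiteBound

theorem hasDerivAt_hermiteFun (n : ℕ) (x : ℝ) :
    HasDerivAt (hermiteFun n) (x * hermiteFun n x - √(2 * (n + 1)) * hermiteFun (n + 1) x) x := by
  have hlin : HasDerivAt (fun x : ℝ => √2 * x) √2 x := by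
    simpa using (hasDerivAt_id x).const_mul √2
  have hpoly := (Polynomial.hasDerivAt_aeval (Polynomial.hermite n) (√2 * x)).comp x hlin
  have hsq : HasDerivAt (fun x : ℝ => -x ^ 2 / 2) (-x) x :=
    ((hasDerivAt_id x).pow 2).neg.div_const 2 |>.congr_deriv <| by
      simp only [id, Nat.cast_ofNat]
      ring
  refine ((hpoly.mul hsq.exp).div_const _).ofReal_comp.congr_deriv ?_
  have hfac : √((n + 1).factorial : ℝ) = √(n + 1) * √(n.factorial) := by
    rw [← Real.sqrt_mul (by positivity), Nat.factorial_succ]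
    push_cast
    rfl
  have hsqrt : √(2 * ((n : ℝ) + 1)) = √2 * √(n + 1) := Real.sqrt_mul zero_le_two _
  have hn : √((n : ℝ) + 1) ≠ 0 := by positivity
  have hn' : √(n.factorial : ℝ) ≠ 0 := by positivity
  have hpi : (Real.pi ^ (1 / 4 : ℝ)) ≠ 0 := by positivity
  simp only [hermiteFun, ← Complex.ofReal_mul, ← Complex.ofReal_sub]
  congr 1
  rw [hfac, hsqrt, Polynomial.hermite_succ, map_sub, map_mul, Polynomial.aeval_X]
  simp only [Function.comp_apply]
  field_simp
  linear_combination
    x * Polynomial.aeval (√2 * x) (Polynomial.hermite n) * Real.mul_self_sqrt zero_le_two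

theorem continuous_hermiteFun (n : ℕ) : Continuous (hermiteFun n) :=
  continuous_iff_continuousAt.2 fun x => (hasDerivAt_hermiteFun n x).continuousAt

theorem integrable_hermiteFun (n : ℕ) : Integrable (hermiteFun n) := by
  obtain ⟨A, hA⟩ := exists_norm_hermiteFun_le (a := 1 / 4) (by norm_num)
  exact ((integrable_exp_neg_mul_sq (by norm_num)).const_mul (A ^ n)).mono'
    (continuous_hermiteFun n).aestronglyMeasurable (ae_of_all _ (hA n))

theorem integrable_mul_hermiteFun (n : ℕ) : Integrable fun x : ℝ => x * hermiteFun n x := by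
  have hcont := continuous_hermiteFun n
  obtain ⟨A, hA⟩ := exists_norm_hermiteFun_le (a := 1 / 4) (by norm_num)
  refine ((integrable_mul_exp_neg_mul_sq (b := 1 / 4) (by norm_num)).norm.const_mul (A ^ n)).mono'
    (by fun_prop) (ae_of_all _ fun x => ?_)
  rw [norm_mul, norm_mul, Complex.norm_real, Real.norm_of_nonneg (Real.exp_pos _).le,
    mul_left_comm]
  gcongr
  exact hA n x

theorem memLp_two_hermiteFun (n : ℕ) : MemLp (hermiteFun n) 2 := by
  have hcont := continuous_hermiteFun n
  obtain ⟨A, hA⟩ := exists_norm_hermiteFun_le (a := 1 / 4) (by norm_num)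
  rw [memLp_two_iff_integrable_sq_norm hcont.aestronglyMeasurable]
  refine ((integrable_exp_neg_mul_sq (b := 1 / 2) (by norm_num)).const_mul ((A ^ n) ^ 2)).mono'
    (by fun_prop) (ae_of_all _ fun x => ?_)
  calc ‖‖hermiteFun n x‖ ^ 2‖
      = ‖hermiteFun n x‖ ^ 2 := Real.norm_of_nonneg (by positivity)
    _ ≤ (A ^ n * Real.exp (-(1 / 4) * x ^ 2)) ^ 2 := by
        gcongr
        exact hA n x
    _ = (A ^ n) ^ 2 * Real.exp (-(1 / 2) * x ^ 2) := by
        rw [mul_pow, ← Real.exp_nat_mul]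
        ring_nf

/-! ### Fourier transform -/

theorem norm_exp_neg_I_mul (u x : ℝ) : ‖Complex.exp (-(Complex.I * u * x))‖ = 1 := by
  simp [Complex.norm_exp]

theorem integrable_exp_neg_I_mul {f : ℝ → ℂ} (hf : Integrable f) (u : ℝ) :
    Integrable fun x : ℝ => Complex.exp (-(Complex.I * u * x)) * f x :=
  hf.bdd_mul (c := 1) (by fun_prop) (ae_of_all _ fun x => (norm_exp_neg_I_mul u x).le)

theorem ft_sub {f g : ℝ → ℂ} (hf : Integrable f) (hg : Integrable g) (u : ℝ) :
    ft (fun x => f x - g x) u = ft f u - ft g u := by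
  simp only [ft, mul_sub]
  exact integral_sub (integrable_exp_neg_I_mul hf u) (integrable_exp_neg_I_mul hg u)

theorem ft_const_mul (c : ℂ) (f : ℝ → ℂ) (u : ℝ) : ft (fun x => c * f x) u = c * ft f u := by
  simp only [ft, mul_left_comm _ c]
  exact integral_const_mul _ _

theorem ft_eq_fourier (f : ℝ → ℂ) (u : ℝ) : ft f u = 𝓕 f (u / (2 * Real.pi)) := by
  rw [ft, Real.fourier_real_eq_integral_exp_smul]
  refine integral_congr_ae (ae_of_all _ fun x => ?_)
  have : (Real.pi : ℂ) ≠ 0 := Complex.ofReal_ne_zero.2 Real.pi_ne_zero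
  simp only [smul_eq_mul]
  congr 2
  push_cast
  field_simp

theorem fourier_eq_ft (f : ℝ → ℂ) (ξ : ℝ) : 𝓕 f ξ = ft f (2 * Real.pi * ξ) := by
  rw [ft_eq_fourier, mul_div_cancel_left₀ _ Real.two_pi_pos.ne']

theorem ft_deriv {f : ℝ → ℂ} (hf : Integrable f) (hd : Differentiable ℝ f)
    (hf' : Integrable (deriv f)) (u : ℝ) : ft (deriv f) u = Complex.I * u * ft f u := by
  have hpi : (Real.pi : ℂ) ≠ 0 := Complex.ofReal_ne_zero.2 Real.pi_ne_zero
  rw [ft_eq_fourier, ft_eq_fourier, Real.fourier_deriv hf hd hf']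
  simp only [smul_eq_mul, Complex.ofReal_div, Complex.ofReal_mul, Complex.ofReal_ofNat]
  field_simp

theorem hasDerivAt_ft {f : ℝ → ℂ} (hf : Integrable f) (hxf : Integrable fun x : ℝ => x * f x)
    (u : ℝ) : HasDerivAt (ft f) (-Complex.I * ft (fun x => x * f x) u) u := by
  have hpi : (Real.pi : ℂ) ≠ 0 := Complex.ofReal_ne_zero.2 Real.pi_ne_zero
  rw [funext (ft_eq_fourier f)]
  refine ((Real.hasDerivAt_fourier hf hxf (u / (2 * Real.pi))).scomp u
    ((hasDerivAt_id u).div_const (2 * Real.pi))).congr_deriv ?_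
  simp only [smul_eq_mul, mul_assoc (-2 * Real.pi * Complex.I : ℂ)]
  rw [fourier_eq_ft, mul_div_cancel₀ _ Real.two_pi_pos.ne', ft_const_mul, Complex.real_smul]
  push_cast
  field_simp

theorem ft_hermiteFun_zero (u : ℝ) :
    ft (hermiteFun 0) u = √(2 * Real.pi) * hermiteFun 0 u := by
  set κ : ℂ := ((Real.pi ^ (1 / 4 : ℝ) : ℝ) : ℂ)⁻¹
  have h_exp : hermiteFun 0 = fun x : ℝ => κ * Complex.exp (-(1 / 2) * x ^ 2) := by
    funext x
    simp only [hermiteFun, Polynomial.hermite_zero, map_one, Nat.factorial_zero, Nat.cast_one,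
      Real.sqrt_one, one_mul, mul_one]
    push_cast
    rw [div_eq_inv_mul]
    congr 2
    ring
  have h_ft : ft (fun x : ℝ => Complex.exp (-(1 / 2) * x ^ 2)) u =
      (Real.pi / (1 / 2)) ^ (1 / 2 : ℂ) * Complex.exp (-(1 / 2) * u ^ 2) := by
    have h := fourierIntegral_gaussian (b := 1 / 2) (by norm_num) (-u)
    simp only [mul_neg, neg_mul] at h
    simp only [ft, neg_mul, h]
    ring_nf
  have h_sqrt : (Real.pi / (1 / 2) : ℂ) ^ (1 / 2 : ℂ) = √(2 * Real.pi) := by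
    rw [Real.sqrt_eq_rpow, Complex.ofReal_cpow (by positivity)]
    push_cast
    ring_nf
  rw [h_exp, ft_const_mul, h_ft, h_sqrt]
  ring

theorem ft_hermiteFun (n : ℕ) (u : ℝ) :
    ft (hermiteFun n) u = √(2 * Real.pi) * (-Complex.I) ^ n * hermiteFun n u := by
  induction n generalizing u with
  | zero => simpa using ft_hermiteFun_zero u
  | succ n ih =>
    have hs : (√(2 * ((n : ℝ) + 1)) : ℂ) ≠ 0 := Complex.ofReal_ne_zero.2 (by positivity)
    set s : ℂ := (√(2 * ((n : ℝ) + 1)) : ℂ)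
    have hd := hasDerivAt_hermiteFun n
    have hderiv := funext fun x => (hd x).deriv
    have hx := integrable_mul_hermiteFun n
    have hs' := (integrable_hermiteFun (n + 1)).const_mul s
    have h_deriv := ft_deriv (integrable_hermiteFun n) (fun x => (hd x).differentiableAt)
      (hderiv ▸ hx.sub hs') u
    have h_mul : -Complex.I * ft (fun x => x * hermiteFun n x) u = _ :=
      (hasDerivAt_ft (integrable_hermiteFun n) hx u).unique
        (funext ih ▸ (hd u).const_mul (√(2 * Real.pi) * (-Complex.I) ^ n : ℂ))
    rw [hderiv, ft_sub hx hs', ft_const_mul, ih] at h_deriv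
    refine mul_left_cancel₀ hs ?_
    linear_combination -h_deriv + Complex.I * h_mul +
      ft (fun x => x * hermiteFun n x) u * Complex.I_sq

/-! ### Field operators on the Fock spaces -/

section Fock

theorem norm_toLp2_sq {ι : Type} (w : ι → ℝ≥0) (u : weightedL2 w) :
    ‖toLp2 w u‖ ^ 2 = ∑' i, (w i : ℝ) * ‖u.1 i‖ ^ 2 := by
  have h := lp.norm_rpow_eq_tsum (p := 2) (by norm_num) (toLp2 w u)
  simp only [ENNReal.toReal_ofNat, Real.rpow_ofNat] at h
  refine h.trans (tsum_congr fun i => ?_)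
  change ‖((√(w i) : ℝ) : ℂ) * u.1 i‖ ^ 2 = _
  rw [norm_mul, mul_pow, Complex.norm_real, Real.norm_of_nonneg (Real.sqrt_nonneg _),
    Real.sq_sqrt (w i).coe_nonneg]

theorem hasSum_conj_mul {ι : Type} {w w' : ι → ℝ≥0} (hw : ∀ i, w i * w' i = 1)
    (u : weightedL2 w) (v : weightedL2 w') :
    HasSum (fun i => conj (u.1 i) * v.1 i) (inner ℂ (toLp2 w u) (toLp2 w' v)) := by
  refine (lp.hasSum_inner (toLp2 w u) (toLp2 w' v)).congr_fun fun i => ?_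
  have hsqrt : (√(w i : ℝ) : ℂ) * √(w' i : ℝ) = 1 := by
    rw [← Complex.ofReal_mul, ← Real.sqrt_mul (w i).coe_nonneg, ← NNReal.coe_mul, hw]
    simp
  change _ = inner ℂ ((√(w i : ℝ) : ℂ) * u.1 i) ((√(w' i : ℝ) : ℂ) * v.1 i)
  rw [RCLike.inner_apply, map_mul, Complex.conj_ofReal]
  linear_combination -(conj (u.1 i) * v.1 i) * hsqrt

theorem letterWeight_pos (n : ℕ) : 0 < letterWeight n := by
  unfold letterWeight
  positivity

theorem wordWeight_cons (p : ℤ) (n : ℕ) (α : List ℕ) :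
    wordWeight p (n :: α) = letterWeight n ^ p * wordWeight p α := by
  simp [wordWeight]

theorem injective_cons : Function.Injective fun x : List ℕ × ℕ => x.2 :: x.1 := by
  rintro ⟨α, n⟩ ⟨β, k⟩ h
  obtain ⟨rfl, rfl⟩ := List.cons.inj h
  rfl

/-- The isometry of `K_p` into the unweighted `ℓ²(ℕ)`; it gives access to the norm of `K_p`. -/
def K.toLp (p : ℤ) : K p →ₗ[ℂ] lp (fun _ : ℕ => ℂ) 2 := toLp2 fun n => letterWeight n ^ p

theorem K.norm_toLp_sq {p : ℤ} (h : K p) :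
    ‖K.toLp p h‖ ^ 2 = ∑' n, ((letterWeight n ^ p : ℝ≥0) : ℝ) * ‖h.1 n‖ ^ 2 :=
  norm_toLp2_sq _ h

theorem hasSum_creation {p : ℤ} (h : K p) (u : Fock p) :
    HasSum (fun α => (wordWeight p α : ℝ) * ‖creation h.1 u.1 α‖ ^ 2)
      (‖K.toLp p h‖ ^ 2 * ‖u‖ ^ 2) := by
  have hs := (mem_weightedL2.1 u.2).mul_of_nonneg (mem_weightedL2.1 h.2)
    (fun α => by positivity) (fun n => by positivity)
  have hprod := (mem_weightedL2.1 u.2).hasSum.mul (mem_weightedL2.1 h.2).hasSum hs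
  rw [← Fock.norm_sq, ← K.norm_toLp_sq, mul_comm] at hprod
  refine (injective_cons.hasSum_iff fun α hα => ?_).1 (hprod.congr_fun fun x => ?_)
  · cases α with
    | nil => simp [creation]
    | cons n α => exact absurd ⟨(α, n), rfl⟩ hα
  · simp only [Function.comp_apply, creation, wordWeight_cons, NNReal.coe_mul, norm_mul]
    ring

/-- The creation operators `ℓ_h : Γ(K_p) → Γ(K_p)` for `h ∈ K_p`. -/
def creationFock (p : ℤ) : K p →ₗ[ℂ] Fock p →ₗ[ℂ] Fock p :=
  LinearMap.mk₂ ℂ (fun h u => (⟨creation h.1 u.1, (hasSum_creation h u).summable⟩ : Fock p))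
    (fun _ _ _ => Subtype.ext <| funext fun
      | [] => (add_zero 0).symm
      | _ :: _ => add_mul _ _ _)
    (fun c _ _ => Subtype.ext <| funext fun
      | [] => (mul_zero c).symm
      | _ :: _ => mul_assoc _ _ _)
    (fun _ _ _ => Subtype.ext <| funext fun
      | [] => (add_zero 0).symm
      | _ :: _ => mul_add _ _ _)
    (fun c _ _ => Subtype.ext <| funext fun
      | [] => (mul_zero c).symm
      | _ :: _ => mul_left_comm _ _ _)

theorem norm_creationFock {p : ℤ} (h : K p) (u : Fock p) :
    ‖creationFock p h u‖ = ‖K.toLp p h‖ * ‖u‖ := by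
  refine (sq_eq_sq₀ (norm_nonneg _) (by positivity)).1 ?_
  rw [Fock.norm_sq, mul_pow]
  exact (hasSum_creation h u).tsum_eq

theorem Fock.summable_cons {p : ℤ} (u : Fock p) :
    Summable fun x : List ℕ × ℕ => (wordWeight p (x.2 :: x.1) : ℝ) * ‖u.1 (x.2 :: x.1)‖ ^ 2 :=
  (mem_weightedL2.1 u.2).comp_injective injective_cons

/-- The component of `u ∈ Γ(K_p) = ℂΩ ⊕ K_p ⊗ Γ(K_p)` along `e_α` in the second factor. -/
def Fock.slice {p : ℤ} (u : Fock p) (α : List ℕ) : K p :=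
  ⟨fun n => u.1 (n :: α), by
    have hα : (wordWeight p α : ℝ) ≠ 0 := NNReal.coe_ne_zero.2 (wordWeight_pos p α).ne'
    refine ((u.summable_cons.prod_factor α).mul_left (wordWeight p α : ℝ)⁻¹).congr fun n => ?_
    rw [wordWeight_cons, NNReal.coe_mul]
    field_simp⟩

theorem Fock.tsum_cons {p : ℤ} (u : Fock p) (α : List ℕ) :
    ∑' n, (wordWeight p (n :: α) : ℝ) * ‖u.1 (n :: α)‖ ^ 2 =
      wordWeight p α * ‖K.toLp p (u.slice α)‖ ^ 2 := by
  rw [K.norm_toLp_sq, ← tsum_mul_left]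
  refine tsum_congr fun n => ?_
  rw [wordWeight_cons, NNReal.coe_mul]
  simp only [slice]
  ring

theorem Fock.summable_slice {p : ℤ} (u : Fock p) :
    Summable fun α => (wordWeight p α : ℝ) * ‖K.toLp p (u.slice α)‖ ^ 2 := by
  simpa only [u.tsum_cons] using u.summable_cons.prod

theorem Fock.tsum_slice_le {p : ℤ} (u : Fock p) :
    ∑' α, (wordWeight p α : ℝ) * ‖K.toLp p (u.slice α)‖ ^ 2 ≤ ‖u‖ ^ 2 := by
  simp only [← u.tsum_cons]
  rw [← u.summable_cons.tsum_prod, Fock.norm_sq]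
  exact tsum_comp_le_tsum_of_inj (mem_weightedL2.1 u.2) (fun α => by positivity) injective_cons

theorem hasSum_annihilation {p : ℤ} (h : K (-p)) (u : Fock p) (α : List ℕ) :
    HasSum (fun n => conj (h.1 n) * u.1 (n :: α))
      (inner ℂ (K.toLp (-p) h) (K.toLp p (u.slice α))) :=
  hasSum_conj_mul (fun n => by
    rw [zpow_neg, inv_mul_cancel₀ (zpow_ne_zero p (letterWeight_pos n).ne')]) h (u.slice α)

theorem wordWeight_mul_norm_annihilation_sq_le {p : ℤ} (h : K (-p)) (u : Fock p) (α : List ℕ) :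
    (wordWeight p α : ℝ) * ‖annihilation h.1 u.1 α‖ ^ 2 ≤
      ‖K.toLp (-p) h‖ ^ 2 * (wordWeight p α * ‖K.toLp p (u.slice α)‖ ^ 2) := by
  have hle : ‖annihilation h.1 u.1 α‖ ≤ ‖K.toLp (-p) h‖ * ‖K.toLp p (u.slice α)‖ := by
    rw [annihilation, (hasSum_annihilation h u α).tsum_eq]
    exact norm_inner_le_norm _ _
  calc (wordWeight p α : ℝ) * ‖annihilation h.1 u.1 α‖ ^ 2
      ≤ wordWeight p α * (‖K.toLp (-p) h‖ * ‖K.toLp p (u.slice α)‖) ^ 2 := by gcongr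
    _ = ‖K.toLp (-p) h‖ ^ 2 * (wordWeight p α * ‖K.toLp p (u.slice α)‖ ^ 2) := by ring

theorem annihilation_mem_fockSubmodule {p : ℤ} (h : K (-p)) (u : Fock p) :
    annihilation h.1 u.1 ∈ fockSubmodule p :=
  mem_weightedL2.2 <| (u.summable_slice.mul_left _).of_nonneg_of_le (fun _ => by positivity)
    (wordWeight_mul_norm_annihilation_sq_le h u)

/-- The annihilation operators `ℓ_h^* : Γ(K_p) → Γ(K_p)` for `h ∈ K_{-p}`. -/
def annihilationFock (p : ℤ) : K (-p) →ₗ⋆[ℂ] Fock p →ₗ[ℂ] Fock p :=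
  LinearMap.mk₂'ₛₗ (starRingEnd ℂ) (RingHom.id ℂ)
    (fun h u => (⟨annihilation h.1 u.1, annihilation_mem_fockSubmodule h u⟩ : Fock p))
    (fun h k u => Subtype.ext <| funext fun α =>
      (tsum_congr fun _ => by simp [add_mul]).trans
        ((hasSum_annihilation h u α).summable.tsum_add (hasSum_annihilation k u α).summable))
    (fun c h u => Subtype.ext <| funext fun α =>
      (tsum_congr fun _ => by simp [mul_assoc]).trans tsum_mul_left)
    (fun h u v => Subtype.ext <| funext fun α =>
      (tsum_congr fun _ => mul_add _ _ _).trans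
        ((hasSum_annihilation h u α).summable.tsum_add (hasSum_annihilation h v α).summable))
    (fun c h u => Subtype.ext <| funext fun α =>
      (tsum_congr fun _ => mul_left_comm _ _ _).trans tsum_mul_left)

theorem norm_annihilationFock_le {p : ℤ} (h : K (-p)) (u : Fock p) :
    ‖annihilationFock p h u‖ ≤ ‖K.toLp (-p) h‖ * ‖u‖ := by
  refine le_of_sq_le_sq ?_ (by positivity)
  calc ‖annihilationFock p h u‖ ^ 2
      = ∑' α, (wordWeight p α : ℝ) * ‖annihilation h.1 u.1 α‖ ^ 2 := Fock.norm_sq _ _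
    _ ≤ ∑' α, ‖K.toLp (-p) h‖ ^ 2 * (wordWeight p α * ‖K.toLp p (u.slice α)‖ ^ 2) :=
        (mem_weightedL2.1 (annihilation_mem_fockSubmodule h u)).tsum_le_tsum
          (wordWeight_mul_norm_annihilation_sq_le h u) (u.summable_slice.mul_left _)
    _ ≤ ‖K.toLp (-p) h‖ ^ 2 * ‖u‖ ^ 2 := by
        rw [tsum_mul_left]
        gcongr
        exact u.tsum_slice_le
    _ = (‖K.toLp (-p) h‖ * ‖u‖) ^ 2 := (mul_pow _ _ _).symm

/-- The inclusion `Γ(K_q) ⊆ Γ(K_p)` for `p ≤ q`. -/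
def Fock.inclusion {p q : ℤ} (h : p ≤ q) : Fock q →ₗ[ℂ] Fock p :=
  Submodule.inclusion (fockSubmodule_anti h)

theorem Fock.norm_inclusion_le {p q : ℤ} (h : p ≤ q) (u : Fock q) :
    ‖Fock.inclusion h u‖ ≤ ‖u‖ := by
  refine le_of_sq_le_sq ?_ (norm_nonneg _)
  rw [Fock.norm_sq, Fock.norm_sq]
  refine (mem_weightedL2.1 (Fock.inclusion h u).2).tsum_le_tsum (fun α => ?_)
    (mem_weightedL2.1 u.2)
  have := wordWeight_mono h α
  exact mul_le_mul_of_nonneg_right (NNReal.coe_le_coe.2 this) (by positivity)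

end Fock

section Field

/-- The operator `ℓ_h + ℓ_h^*` from `Γ(K_p)` to `Γ(K_{-p})` for `h ∈ K_{-p}`. -/
def fieldFock (p : ℕ) (h : K (-(p : ℤ))) : Fock p →ₗ[ℂ] Fock (-(p : ℤ)) :=
  have hp : -(p : ℤ) ≤ p := by omega
  creationFock _ h ∘ₗ Fock.inclusion hp + Fock.inclusion hp ∘ₗ annihilationFock p h

theorem norm_fieldFock_le (p : ℕ) (h : K (-(p : ℤ))) (u : Fock p) :
    ‖fieldFock p h u‖ ≤ 2 * ‖K.toLp _ h‖ * ‖u‖ := by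
  have hp : -(p : ℤ) ≤ p := by omega
  calc ‖fieldFock p h u‖
      ≤ ‖creationFock _ h (Fock.inclusion hp u)‖ +
          ‖Fock.inclusion hp (annihilationFock p h u)‖ := norm_add_le _ _
    _ ≤ ‖K.toLp _ h‖ * ‖u‖ + ‖K.toLp _ h‖ * ‖u‖ := by
        rw [norm_creationFock]
        gcongr
        · exact Fock.norm_inclusion_le hp u
        · exact (Fock.norm_inclusion_le hp _).trans (norm_annihilationFock_le h u)
    _ = 2 * ‖K.toLp _ h‖ * ‖u‖ := by ring

theorem fieldFock_sub {p : ℕ} (h k : K (-(p : ℤ))) :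
    fieldFock p (h - k) = fieldFock p h - fieldFock p k := by
  simp only [fieldFock, map_sub, LinearMap.sub_comp, LinearMap.comp_sub]
  abel

theorem fieldFock_ofReal_smul {p : ℕ} (s : ℝ) (h : K (-(p : ℤ))) :
    fieldFock p ((s : ℂ) • h) = (s : ℂ) • fieldFock p h := by
  simp only [fieldFock, map_smulₛₗ, RingHom.id_apply, Complex.conj_ofReal, LinearMap.smul_comp,
    LinearMap.comp_smul, smul_add]

theorem G1.continuous_toFock (p : ℕ) : Continuous (G1.toFock p) :=
  continuous_iInf_dom continuous_induced_dom

/-- The operator `ℓ_h + ℓ_h^*` in `L(G̃₁, G̃₋₁)` for `h ∈ K_{-p}`. -/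
def field (p : ℕ) (h : K (-(p : ℤ))) : G1 →L[ℂ] Gm1 where
  toLinearMap := Gm1.ofFock p ∘ₗ fieldFock p h ∘ₗ G1.toFock p
  cont := (Gm1.continuous_ofFock p).comp <|
    (AddMonoidHomClass.continuous_of_bound (fieldFock p h) _ (norm_fieldFock_le p h)).comp
      (G1.continuous_toFock p)

theorem field_apply (p : ℕ) (h : K (-(p : ℤ))) (f : G1) :
    field p h f = Gm1.ofFock p (fieldFock p h (G1.toFock p f)) :=
  rfl

theorem coeff_field (p : ℕ) (h : K (-(p : ℤ))) (f : G1) :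
    (field p h f).coeff = freeField h.1 f.coeff :=
  rfl

theorem tendsto_field_zero {ι : Type*} {l : Filter ι} {p : ℕ} {h : ι → K (-(p : ℤ))}
    (hh : Tendsto (fun i => ‖K.toLp _ (h i)‖) l (𝓝 0)) (f : G1) :
    Tendsto (fun i => field p (h i) f) l (𝓝 0) := by
  have hFock : Tendsto (fun i => fieldFock p (h i) (G1.toFock p f)) l (𝓝 0) := by
    refine squeeze_zero_norm (fun i => norm_fieldFock_le p (h i) _) ?_
    simpa using (hh.const_mul 2).mul_const ‖G1.toFock p f‖
  simpa only [map_zero] using! ((Gm1.continuous_ofFock p).tendsto 0).comp hFock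

theorem tendsto_slope_field {p : ℕ} {h : ℝ → K (-(p : ℤ))} {h' : K (-(p : ℤ))} {t : ℝ}
    (hh : Tendsto (fun s : ℝ => ‖K.toLp _ ((s : ℂ)⁻¹ • (h (t + s) - h t) - h')‖) (𝓝[≠] 0) (𝓝 0))
    (f : G1) :
    Tendsto (fun s : ℝ => (s : ℂ)⁻¹ • (field p (h (t + s)) f - field p (h t) f)) (𝓝[≠] 0)
      (𝓝 (field p h' f)) := by
  have hlim := (tendsto_field_zero hh f).add_const (field p h' f)
  rw [zero_add] at hlim
  refine hlim.congr fun s => ?_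
  rw [field_apply, fieldFock_sub, ← Complex.ofReal_inv, fieldFock_ofReal_smul, fieldFock_sub]
  simp only [field_apply, LinearMap.sub_apply, LinearMap.smul_apply, map_sub, map_smul,
    sub_add_cancel]

end Field

/-! ### Hermite coefficients computed on the Fourier side -/

section HermiteCoeff

theorem exists_norm_toLp_le_of_geometric {A C : ℝ} {p : ℕ} (hp : 2 * A ^ 2 ≤ 2 ^ p) {h : ℕ → ℂ}
    (hh : ∀ n, ‖h n‖ ≤ C * A ^ n) :
    ∃ hK : h ∈ K (-(p : ℤ)), ‖K.toLp _ ⟨h, hK⟩‖ ≤ 2 * C := by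
  have hC : 0 ≤ C := by simpa using (norm_nonneg _).trans (hh 0)
  have hle (n : ℕ) :
      ((letterWeight n ^ (-(p : ℤ)) : ℝ≥0) : ℝ) * ‖h n‖ ^ 2 ≤ C ^ 2 * (1 / 2) ^ n := by
    have hw : (2 * A ^ 2) ^ n ≤ (letterWeight n : ℝ) ^ p := by
      calc (2 * A ^ 2) ^ n ≤ ((2 : ℝ) ^ p) ^ n := by gcongr
        _ = (2 ^ n) ^ p := pow_right_comm _ _ _
        _ ≤ (letterWeight n : ℝ) ^ p := by
          rw [letterWeight, NNReal.coe_pow, NNReal.coe_ofNat]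
          gcongr
          exacts [one_le_two, n.le_succ]
    rw [zpow_neg, zpow_natCast, NNReal.coe_inv, NNReal.coe_pow,
      inv_mul_le_iff₀ (pow_pos (NNReal.coe_pos.2 (letterWeight_pos n)) p)]
    calc ‖h n‖ ^ 2 ≤ (C * A ^ n) ^ 2 := by
          gcongr
          exact hh n
      _ = (2 * A ^ 2) ^ n * (C ^ 2 * (1 / 2) ^ n) := by
          rw [mul_pow 2, one_div, inv_pow]
          field_simp
          ring
      _ ≤ (letterWeight n : ℝ) ^ p * (C ^ 2 * (1 / 2) ^ n) := by gcongr
  have hgeom := summable_geometric_two.mul_left (C ^ 2)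
  have hsum := hgeom.of_nonneg_of_le (fun n => by positivity) hle
  refine ⟨hsum, le_of_sq_le_sq ?_ (by positivity)⟩
  calc ‖K.toLp _ ⟨h, hsum⟩‖ ^ 2
      ≤ ∑' n : ℕ, C ^ 2 * (1 / 2) ^ n := by
        rw [K.norm_toLp_sq]
        exact hsum.tsum_le_tsum hle hgeom
    _ ≤ (2 * C) ^ 2 := by
        rw [tsum_mul_left, tsum_geometric_two]
        nlinarith [sq_nonneg C]

theorem continuous_ft_hermiteFun (n : ℕ) : Continuous (ft (hermiteFun n)) := by
  rw [funext (ft_hermiteFun n)]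
  exact (continuous_hermiteFun n).const_mul _

theorem norm_ft_hermiteFun (n : ℕ) (u : ℝ) :
    ‖ft (hermiteFun n) u‖ = √(2 * Real.pi) * ‖hermiteFun n u‖ := by
  rw [ft_hermiteFun, norm_mul, norm_mul, norm_pow, norm_neg, Complex.norm_I, one_pow, mul_one,
    Complex.norm_real, Real.norm_of_nonneg (Real.sqrt_nonneg _)]

/-- The coefficients `⟨e_{n+1}, g⟩` of the generalized function `g` with Fourier transform `ψ`,
in the form given by Plancherel's formula. -/
def hermiteCoeff (ψ : ℝ → ℂ) (n : ℕ) : ℂ :=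
  (1 / (2 * Real.pi) : ℂ) * ∫ u : ℝ, ψ u * conj (ft (hermiteFun n) u)

variable {a : ℝ} {ψ ψ₁ ψ₂ : ℝ → ℂ}

theorem norm_mul_conj_ft_hermiteFun_le {A : ℝ}
    (hA : ∀ n x, ‖hermiteFun n x‖ ≤ A ^ n * Real.exp (-a * x ^ 2)) (ψ : ℝ → ℂ) (n : ℕ) (u : ℝ) :
    ‖ψ u * conj (ft (hermiteFun n) u)‖ ≤
      √(2 * Real.pi) * A ^ n * ‖Real.exp (-a * u ^ 2) • ψ u‖ := by
  rw [norm_mul, RCLike.norm_conj, norm_ft_hermiteFun, norm_smul,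
    Real.norm_of_nonneg (Real.exp_pos _).le]
  calc ‖ψ u‖ * (√(2 * Real.pi) * ‖hermiteFun n u‖)
      ≤ ‖ψ u‖ * (√(2 * Real.pi) * (A ^ n * Real.exp (-a * u ^ 2))) := by
        gcongr
        exact hA n u
    _ = √(2 * Real.pi) * A ^ n * (Real.exp (-a * u ^ 2) * ‖ψ u‖) := by ring

theorem aestronglyMeasurable_of_integrable_exp_smul
    (hψ : Integrable fun u => Real.exp (-a * u ^ 2) • ψ u) : AEStronglyMeasurable ψ := by
  have hexp : Continuous fun u : ℝ => Real.exp (a * u ^ 2) := by fun_prop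
  refine (hexp.aestronglyMeasurable.smul hψ.aestronglyMeasurable).congr (ae_of_all _ fun u => ?_)
  simp [← Complex.exp_add, ← mul_assoc]

theorem integrable_mul_conj_ft_hermiteFun (ha : a < 1 / 2)
    (hψ : Integrable fun u => Real.exp (-a * u ^ 2) • ψ u) (n : ℕ) :
    Integrable fun u => ψ u * conj (ft (hermiteFun n) u) := by
  obtain ⟨A, hA⟩ := exists_norm_hermiteFun_le ha
  have hconj := Complex.continuous_conj.comp (continuous_ft_hermiteFun n)
  exact (hψ.norm.const_mul _).mono'
    ((aestronglyMeasurable_of_integrable_exp_smul hψ).mul hconj.aestronglyMeasurable)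
    (ae_of_all _ (norm_mul_conj_ft_hermiteFun_le hA ψ n))

theorem norm_hermiteCoeff_le {A : ℝ}
    (hA : ∀ n x, ‖hermiteFun n x‖ ≤ A ^ n * Real.exp (-a * x ^ 2))
    (hψ : Integrable fun u => Real.exp (-a * u ^ 2) • ψ u) (n : ℕ) :
    ‖hermiteCoeff ψ n‖ ≤ (∫ u, ‖Real.exp (-a * u ^ 2) • ψ u‖) * A ^ n := by
  have hA₀ : 0 ≤ A ^ n := by
    simpa using (norm_nonneg _).trans (hA n 0)
  have hint := norm_integral_le_of_norm_le (hψ.norm.const_mul _)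
    (ae_of_all _ (norm_mul_conj_ft_hermiteFun_le hA ψ n))
  rw [integral_const_mul] at hint
  have hpi : 1 ≤ √(2 * Real.pi) := Real.one_le_sqrt.2 (by linarith [Real.pi_gt_three])
  have hnorm : ‖(1 / (2 * Real.pi) : ℂ)‖ = (√(2 * Real.pi) ^ 2)⁻¹ := by
    rw [Real.sq_sqrt Real.two_pi_pos.le]
    simp [abs_of_pos Real.pi_pos]
  rw [hermiteCoeff, norm_mul, hnorm, inv_mul_le_iff₀ (by positivity)]
  calc _ ≤ √(2 * Real.pi) * A ^ n * ∫ u, ‖Real.exp (-a * u ^ 2) • ψ u‖ := hint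
    _ ≤ √(2 * Real.pi) ^ 2 * A ^ n * ∫ u, ‖Real.exp (-a * u ^ 2) • ψ u‖ := by
        gcongr
        exact le_self_pow₀ hpi two_ne_zero
    _ = √(2 * Real.pi) ^ 2 * ((∫ u, ‖Real.exp (-a * u ^ 2) • ψ u‖) * A ^ n) := by ring

theorem exists_norm_toLp_hermiteCoeff_le (ha : a < 1 / 2) :
    ∃ p : ℕ, ∀ ψ : ℝ → ℂ, Integrable (fun u => Real.exp (-a * u ^ 2) • ψ u) →
      ∃ hK : hermiteCoeff ψ ∈ K (-(p : ℤ)),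
        ‖K.toLp _ ⟨hermiteCoeff ψ, hK⟩‖ ≤ 2 * ∫ u, ‖Real.exp (-a * u ^ 2) • ψ u‖ := by
  obtain ⟨A, hA⟩ := exists_norm_hermiteFun_le ha
  obtain ⟨p, hp⟩ := pow_unbounded_of_one_lt (2 * A ^ 2) one_lt_two
  exact ⟨p, fun ψ hψ => exists_norm_toLp_le_of_geometric hp.le (norm_hermiteCoeff_le hA hψ)⟩

theorem hermiteCoeff_const_mul (c : ℂ) (ψ : ℝ → ℂ) :
    hermiteCoeff (fun u => c * ψ u) = c • hermiteCoeff ψ := by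
  funext n
  simp only [hermiteCoeff, mul_assoc c, integral_const_mul, Pi.smul_apply, smul_eq_mul]
  ring

theorem hermiteCoeff_sub (ha : a < 1 / 2)
    (hψ₁ : Integrable fun u => Real.exp (-a * u ^ 2) • ψ₁ u)
    (hψ₂ : Integrable fun u => Real.exp (-a * u ^ 2) • ψ₂ u) :
    hermiteCoeff (fun u => ψ₁ u - ψ₂ u) = hermiteCoeff ψ₁ - hermiteCoeff ψ₂ := by
  funext n
  simp only [hermiteCoeff, Pi.sub_apply, sub_mul]
  rw [integral_sub (integrable_mul_conj_ft_hermiteFun ha hψ₁ n)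
    (integrable_mul_conj_ft_hermiteFun ha hψ₂ n), mul_sub]

/-- Differentiability of `t ↦ Ψ t` in `L¹(e^{-a u²} du)`, where `Ψ t` stands for the Fourier
transform of `h t`, passes to the field operators `ℓ_{h t} + ℓ_{h t}^*`. -/
theorem exists_hasDeriv_field {Ψ Ψ' : ℝ → ℝ → ℂ} (ha : a < 1 / 2)
    (hΨ : ∀ t, Integrable fun u => Real.exp (-a * u ^ 2) • Ψ t u)
    (hΨ' : ∀ t, Integrable fun u => Real.exp (-a * u ^ 2) • Ψ' t u)
    (hlim : ∀ t, Tendsto (fun s : ℝ => ∫ u, ‖Real.exp (-a * u ^ 2) •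
      ((s : ℂ)⁻¹ * (Ψ (t + s) u - Ψ t u) - Ψ' t u)‖) (𝓝[≠] 0) (𝓝 0)) :
    ∃ X W : ℝ → (G1 →L[ℂ] Gm1),
      (∀ t f, (X t f).coeff = freeField (hermiteCoeff (Ψ t)) f.coeff) ∧
      ∀ t f, Tendsto (fun s : ℝ => (s : ℂ)⁻¹ • (X (t + s) f - X t f)) (𝓝[≠] 0)
        (𝓝 (W t f)) := by
  obtain ⟨p, hp⟩ := exists_norm_toLp_hermiteCoeff_le ha
  choose hK hle using hp
  let h (t : ℝ) : K (-(p : ℤ)) := ⟨_, hK _ (hΨ t)⟩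
  let h' (t : ℝ) : K (-(p : ℤ)) := ⟨_, hK _ (hΨ' t)⟩
  refine ⟨fun t => field p (h t), fun t => field p (h' t), fun t f => coeff_field p _ f,
    fun t f => tendsto_slope_field ?_ f⟩
  refine squeeze_zero (fun s => norm_nonneg _) (fun s => ?_)
    (by simpa only [mul_zero] using (hlim t).const_mul 2)
  have hdiff : Integrable fun u => Real.exp (-a * u ^ 2) • (Ψ (t + s) u - Ψ t u) := by
    simpa only [smul_sub] using! (hΨ (t + s)).sub (hΨ t)
  have hsmul : Integrable fun u =>
      Real.exp (-a * u ^ 2) • ((s : ℂ)⁻¹ * (Ψ (t + s) u - Ψ t u)) := by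
    simpa only [mul_smul_comm] using hdiff.const_mul (s : ℂ)⁻¹
  have hquot : Integrable fun u =>
      Real.exp (-a * u ^ 2) • ((s : ℂ)⁻¹ * (Ψ (t + s) u - Ψ t u) - Ψ' t u) := by
    simpa only [smul_sub] using! hsmul.sub (hΨ' t)
  have hcoeff : hermiteCoeff (fun u => (s : ℂ)⁻¹ * (Ψ (t + s) u - Ψ t u) - Ψ' t u) =
      (s : ℂ)⁻¹ • (hermiteCoeff (Ψ (t + s)) - hermiteCoeff (Ψ t)) - hermiteCoeff (Ψ' t) := by
    rw [hermiteCoeff_sub ha hsmul (hΨ' t), hermiteCoeff_const_mul,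
      hermiteCoeff_sub ha (hΨ (t + s)) (hΨ t)]
  convert hle _ hquot using 3
  exact Subtype.ext hcoeff.symm

end HermiteCoeff

section Indicator

theorem memLp_indicatorTo (t : ℝ) (p : ℝ≥0∞) : MemLp (indicatorTo t) p := by
  have hIcc (x y : ℝ) : MemLp ((Set.Icc x y).indicator (1 : ℝ → ℂ)) p :=
    memLp_indicator_const p measurableSet_Icc 1 (Or.inr (by simp))
  unfold indicatorTo
  split_ifs
  exacts [hIcc 0 t, (hIcc t 0).neg]

theorem integrable_indicatorTo (t : ℝ) : Integrable (indicatorTo t) :=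
  memLp_one_iff_integrable.1 (memLp_indicatorTo t 1)

theorem continuous_fourier {f : ℝ → ℂ} (hf : Integrable f) : Continuous (𝓕 f) :=
  VectorFourier.fourierIntegral_continuous Real.continuous_fourierChar
    (by exact continuous_inner) hf

theorem continuous_ft {f : ℝ → ℂ} (hf : Integrable f) : Continuous (ft f) := by
  rw [funext (ft_eq_fourier f)]
  exact (continuous_fourier hf).comp (continuous_id.div_const _)

theorem ft_indicatorTo (t u : ℝ) :
    ft (indicatorTo t) u = ∫ x in (0 : ℝ)..t, Complex.exp (-(Complex.I * u * x)) := by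
  have hIcc (x y : ℝ) : ft ((Set.Icc x y).indicator 1) u =
      ∫ v in Set.Ioc x y, Complex.exp (-(Complex.I * u * v)) := by
    rw [← integral_Icc_eq_integral_Ioc, ← integral_indicator measurableSet_Icc]
    simp only [ft, Set.indicator_apply, Pi.one_apply, mul_ite, mul_one, mul_zero]
  unfold indicatorTo
  split_ifs with ht
  · rw [intervalIntegral.integral_of_le ht, hIcc]
  · rw [intervalIntegral.integral_of_ge (not_le.1 ht).le, ← hIcc]
    simp only [ft, Pi.neg_apply, mul_neg, integral_neg]

theorem hasDerivAt_ft_indicatorTo (t u : ℝ) :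
    HasDerivAt (fun t => ft (indicatorTo t) u) (Complex.exp (-(Complex.I * u * t))) t := by
  simp only [ft_indicatorTo]
  exact (by fun_prop : Continuous fun x : ℝ =>
    Complex.exp (-(Complex.I * u * x))).integral_hasStrictDerivAt 0 t |>.hasDerivAt

theorem norm_ft_indicatorTo_sub_le (s t u : ℝ) :
    ‖ft (indicatorTo s) u - ft (indicatorTo t) u‖ ≤ |s - t| := by
  have h := Convex.norm_image_sub_le_of_norm_hasDerivWithin_le (C := 1)
    (fun x _ => (hasDerivAt_ft_indicatorTo x u).hasDerivWithinAt)
    (fun x _ => (norm_exp_neg_I_mul u x).le) convex_univ (Set.mem_univ t) (Set.mem_univ s)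
  rwa [one_mul, Real.norm_eq_abs] at h

theorem norm_ft_indicatorTo_le (t u : ℝ) : ‖ft (indicatorTo t) u‖ ≤ |t| := by
  simpa [ft_indicatorTo 0] using norm_ft_indicatorTo_sub_le t 0 u

theorem abs_mul_norm_ft_indicatorTo_le (t u : ℝ) : |u| * ‖ft (indicatorTo t) u‖ ≤ 2 := by
  rcases eq_or_ne u 0 with rfl | hu
  · simp
  have hprim : ft (indicatorTo t) u =
      (Complex.exp (-(Complex.I * u * t)) - 1) / -(Complex.I * u) := by
    rw [ft_indicatorTo]
    simpa using integral_exp_mul_complex (a := 0) (b := t) (c := -(Complex.I * u)) (by simp [hu])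
  have hnorm : ‖-(Complex.I * u)‖ = |u| := by simp
  rw [hprim, norm_div, hnorm, mul_div_cancel₀ _ (abs_ne_zero.2 hu)]
  calc ‖Complex.exp (-(Complex.I * u * t)) - 1‖
      ≤ ‖Complex.exp (-(Complex.I * u * t))‖ + ‖(1 : ℂ)‖ := norm_sub_le _ _
    _ = 2 := by rw [norm_exp_neg_I_mul, norm_one, one_add_one_eq_two]

theorem sq_norm_ft_indicatorTo_le (t u : ℝ) :
    ‖ft (indicatorTo t) u‖ ^ 2 ≤ (t ^ 2 + 4) / (1 + u ^ 2) := by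
  rw [le_div_iff₀ (by positivity)]
  calc ‖ft (indicatorTo t) u‖ ^ 2 * (1 + u ^ 2)
      = ‖ft (indicatorTo t) u‖ ^ 2 + (|u| * ‖ft (indicatorTo t) u‖) ^ 2 := by
        rw [mul_pow, sq_abs]
        ring
    _ ≤ |t| ^ 2 + 2 ^ 2 := by
        gcongr
        exacts [norm_ft_indicatorTo_le t u, abs_mul_norm_ft_indicatorTo_le t u]
    _ = t ^ 2 + 4 := by
        rw [sq_abs]
        norm_num

theorem norm_slope_ft_indicatorTo_sub_le (t u : ℝ) {s : ℝ} (hs : s ≠ 0) :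
    ‖(s : ℂ)⁻¹ * (ft (indicatorTo (t + s)) u - ft (indicatorTo t) u) -
      Complex.exp (-(Complex.I * u * t))‖ ≤ 2 := by
  have hslope : ‖(s : ℂ)⁻¹ * (ft (indicatorTo (t + s)) u - ft (indicatorTo t) u)‖ ≤ 1 := by
    rw [norm_mul, norm_inv, Complex.norm_real, Real.norm_eq_abs, inv_mul_le_iff₀ (abs_pos.2 hs),
      mul_one]
    simpa using norm_ft_indicatorTo_sub_le (t + s) t u
  rw [← one_add_one_eq_two]
  exact (norm_sub_le _ _).trans (add_le_add hslope (norm_exp_neg_I_mul u t).le)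

theorem tendsto_integral_slope_ft_indicatorTo {φ : ℝ → ℂ} (hφ : Integrable φ) (t : ℝ) :
    Tendsto (fun s : ℝ => ∫ u, ‖φ u * ((s : ℂ)⁻¹ *
      (ft (indicatorTo (t + s)) u - ft (indicatorTo t) u) - Complex.exp (-(Complex.I * u * t)))‖)
      (𝓝[≠] 0) (𝓝 0) := by
  set F : ℝ → ℝ → ℂ := fun s u => φ u * ((s : ℂ)⁻¹ *
    (ft (indicatorTo (t + s)) u - ft (indicatorTo t) u) - Complex.exp (-(Complex.I * u * t)))
  have hcont (s : ℝ) := continuous_ft (integrable_indicatorTo s)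
  have hmeas (s : ℝ) : AEStronglyMeasurable fun u => ‖F s u‖ :=
    (hφ.aestronglyMeasurable.mul (by fun_prop)).norm
  have hbound : ∀ᶠ s in 𝓝[≠] (0 : ℝ), ∀ᵐ u, ‖‖F s u‖‖ ≤ ‖φ u‖ * 2 := by
    filter_upwards [self_mem_nhdsWithin] with s hs
    refine ae_of_all _ fun u => ?_
    rw [norm_norm, norm_mul]
    gcongr
    exact norm_slope_ft_indicatorTo_sub_le t u hs
  have hpoint (u : ℝ) : Tendsto (fun s => ‖F s u‖) (𝓝[≠] 0) (𝓝 0) := by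
    have hslope := (hasDerivAt_ft_indicatorTo t u).tendsto_slope_zero
    simp only [← Complex.ofReal_inv, ← Complex.real_smul, F]
    simpa using ((hslope.sub_const (Complex.exp (-(Complex.I * u * t)))).const_mul (φ u)).norm
  simpa only [integral_zero] using tendsto_integral_filter_of_dominated_convergence _
    (Eventually.of_forall hmeas) hbound (hφ.norm.mul_const 2) (ae_of_all _ hpoint)

end Indicator

/-! ### Fourier multipliers -/

section Multiplier

theorem fourier_toLp_ae_eq {f : ℝ → ℂ} (hf₁ : Integrable f) (hf₂ : MemLp f 2) :
    ((𝓕 (hf₂.toLp f) : Lp ℂ 2 (volume : Measure ℝ)) : ℝ → ℂ) =ᵐ[volume] 𝓕 f := by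
  refine ae_eq_of_integral_contDiff_smul_eq ((Lp.memLp _).locallyIntegrable one_le_two)
    (continuous_fourier hf₁).locallyIntegrable fun g hg hgc => ?_
  have hgc' : HasCompactSupport (fun x => (g x : ℂ)) := hgc.comp_left Complex.ofReal_zero
  let φ : SchwartzMap ℝ ℂ := hgc'.toSchwartzMap (Complex.ofRealCLM.contDiff.comp hg)
  have hdistr := DFunLike.congr_fun (Lp.fourier_toTemperedDistribution_eq (hf₂.toLp f)) φ
  rw [TemperedDistribution.fourier_apply, Lp.toTemperedDistribution_apply,
    Lp.toTemperedDistribution_apply] at hdistr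
  have hflip : ∫ x, 𝓕 (φ : ℝ → ℂ) x • f x = ∫ x, φ x • 𝓕 f x := by
    simpa using! VectorFourier.integral_fourierIntegral_smul_eq_flip (L := innerₗ ℝ)
      Real.continuous_fourierChar continuous_inner φ.integrable hf₁
  have hφ (x : ℝ) : φ x = (g x : ℂ) := rfl
  calc ∫ x, g x • (𝓕 (hf₂.toLp f) : Lp ℂ 2 (volume : Measure ℝ)) x
      = ∫ x, 𝓕 φ x • hf₂.toLp f x := by
        simpa only [hφ, Complex.real_smul, smul_eq_mul] using hdistr.symm
    _ = ∫ x, 𝓕 (φ : ℝ → ℂ) x • f x := integral_congr_ae <| by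
        filter_upwards [hf₂.coeFn_toLp] with x hx
        rw [hx, SchwartzMap.fourier_coe]
    _ = ∫ x, g x • 𝓕 f x := by
        simpa only [hφ, Complex.real_smul, smul_eq_mul] using hflip

theorem hermiteCoeff_eq_integral {g : Lp ℂ 2 (volume : Measure ℝ)} {ψ : ℝ → ℂ}
    (hg : ((𝓕 g : Lp ℂ 2 (volume : Measure ℝ)) : ℝ → ℂ) =ᵐ[volume]
      fun ξ => ψ (2 * Real.pi * ξ)) (n : ℕ) :
    hermiteCoeff ψ n = ∫ x : ℝ, conj (hermiteFun n x) * g x := by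
  let e : Lp ℂ 2 (volume : Measure ℝ) := (memLp_two_hermiteFun n).toLp _
  have hinner : inner ℂ e g = ∫ x : ℝ, conj (hermiteFun n x) * g x := by
    rw [L2.inner_def]
    refine integral_congr_ae ?_
    filter_upwards [(memLp_two_hermiteFun n).coeFn_toLp] with x hx
    rw [RCLike.inner_apply, hx, mul_comm]
  have hinner_fourier : inner ℂ (𝓕 e) (𝓕 g) =
      ∫ ξ : ℝ, ψ (2 * Real.pi * ξ) * conj (ft (hermiteFun n) (2 * Real.pi * ξ)) := by
    rw [L2.inner_def]
    refine integral_congr_ae ?_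
    filter_upwards [hg,
      fourier_toLp_ae_eq (integrable_hermiteFun n) (memLp_two_hermiteFun n)] with ξ hgξ heξ
    rw [RCLike.inner_apply, hgξ, heξ, fourier_eq_ft]
  rw [← hinner, ← Lp.inner_fourier_eq, hinner_fourier,
    Measure.integral_comp_mul_left (fun u => ψ u * conj (ft (hermiteFun n) u)),
    abs_of_pos (inv_pos.2 Real.two_pi_pos), Complex.real_smul, hermiteCoeff]
  push_cast
  rw [one_div]

theorem memLp_comp_mul_left {G : ℝ → ℂ} {p : ℝ≥0∞} (hG : MemLp G p) {c : ℝ} (hc : c ≠ 0) :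
    MemLp (fun ξ => G (c * ξ)) p := by
  refine MemLp.comp_of_map (f := (c * ·)) ?_ (by fun_prop)
  rw [Real.map_volume_mul_left hc]
  exact hG.smul_measure ENNReal.ofReal_ne_top

theorem exists_isTm {m : ℝ → ℝ} {f : ℝ → ℂ} (hf₁ : Integrable f) (hf₂ : MemLp f 2)
    (hmf : MemLp (fun u => (√(m u) : ℂ) * ft f u) 2) :
    ∃ g : Lp ℂ 2 (volume : Measure ℝ), IsTm m (hf₂.toLp f) g ∧
      ∀ n, hermiteCoeff (fun u => √(m u) * ft f u) n =
        ∫ x : ℝ, conj (hermiteFun n x) * g x := by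
  have hmf' := memLp_comp_mul_left hmf Real.two_pi_pos.ne'
  have hfourier : 𝓕 (𝓕⁻ (hmf'.toLp _)) = hmf'.toLp _ := FourierTransform.fourier_fourierInv_eq _
  refine ⟨𝓕⁻ (hmf'.toLp _), ?_, hermiteCoeff_eq_integral ?_⟩
  · rw [IsTm, hfourier]
    filter_upwards [hmf'.coeFn_toLp, fourier_toLp_ae_eq hf₁ hf₂] with ξ hgξ hfξ
    rw [hgξ, hfξ, fourier_eq_ft]
  · rw [hfourier]
    exact hmf'.coeFn_toLp

variable {m : ℝ → ℝ}

theorem memLp_sqrt_mul_ft_indicatorTo (hm : AEStronglyMeasurable fun u => (√(m u) : ℂ))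
    (hm₀ : ∀ u, 0 ≤ m u) (hint : Integrable fun u : ℝ => m u / (1 + u ^ 2)) (t : ℝ) :
    MemLp (fun u => (√(m u) : ℂ) * ft (indicatorTo t) u) 2 := by
  have hmeas := hm.mul (continuous_ft (integrable_indicatorTo t)).aestronglyMeasurable
  refine (memLp_two_iff_integrable_sq_norm hmeas).2 <|
    (hint.const_mul (t ^ 2 + 4)).mono' (hmeas.norm.pow 2) (ae_of_all _ fun u => ?_)
  rw [norm_pow, norm_norm]
  calc ‖(√(m u) : ℂ) * ft (indicatorTo t) u‖ ^ 2
      = m u * ‖ft (indicatorTo t) u‖ ^ 2 := by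
        rw [norm_mul, mul_pow, Complex.norm_real, Real.norm_eq_abs, sq_abs,
          Real.sq_sqrt (hm₀ u)]
    _ ≤ m u * ((t ^ 2 + 4) / (1 + u ^ 2)) := by
        gcongr
        exacts [hm₀ u, sq_norm_ft_indicatorTo_le t u]
    _ = (t ^ 2 + 4) * (m u / (1 + u ^ 2)) := by ring

end Multiplier

section Density

variable {m : ℝ → ℝ} {a : ℝ}

theorem integrable_exp_smul_sqrt_mul {F : ℝ → ℂ} {c : ℝ}
    (hint : Integrable fun u => Real.exp (-a * u ^ 2) * √(m u)) (hF : Continuous F)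
    (hFc : ∀ u, ‖F u‖ ≤ c) :
    Integrable fun u => Real.exp (-a * u ^ 2) • ((√(m u) : ℂ) * F u) := by
  simpa only [Complex.real_smul, RCLike.ofReal_mul, mul_assoc] using!
    hint.ofReal.mul_bdd (𝕜 := ℂ) hF.aestronglyMeasurable (ae_of_all _ hFc)

theorem integrableOn_sqrt_of_le_rpow {b K : ℝ} (hb : b < 2) (hm : Measurable m)
    (hle : ∀ u : ℝ, u ≠ 0 → |u| ≤ 1 → m u ≤ K * |u| ^ (-b)) :
    IntegrableOn (fun u => √(m u)) (Set.Icc (-1) 1) := by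
  have hrpow : IntegrableOn (fun u : ℝ => |u| ^ (-(b / 2))) (Set.Icc (-1) 1) := by
    refine LocallyIntegrable.integrableOn_isCompact ?_ isCompact_Icc
    refine locallyIntegrable_of_norm_le_rpow (C := 1) (α := b / 2) (by simp)
      (by simp; linarith) (ae_of_all _ fun u => ?_)
      (Measurable.aestronglyMeasurable (by fun_prop))
    rw [one_mul, Real.norm_eq_abs, Real.norm_eq_abs, abs_of_nonneg (by positivity)]
  refine (hrpow.const_mul √K).mono' (hm.sqrt.aestronglyMeasurable) ?_
  filter_upwards [ae_restrict_mem measurableSet_Icc,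
    ae_restrict_of_ae (compl_mem_ae_iff.2 (measure_singleton (0 : ℝ)))] with u hu hu₀
  rw [Real.norm_of_nonneg (Real.sqrt_nonneg _)]
  calc √(m u) ≤ √(K * |u| ^ (-b)) := Real.sqrt_le_sqrt (hle u hu₀ (abs_le.2 hu))
    _ = √K * |u| ^ (-(b / 2)) := by
      rw [Real.sqrt_mul' _ (by positivity), Real.sqrt_eq_rpow (|u| ^ (-b)),
        ← Real.rpow_mul (abs_nonneg u), mul_one_div, neg_div]

theorem integrableOn_exp_mul_sqrt_of_le_exp {C₁ C₂ : ℝ} (ha : 0 < a) (hm : Measurable m)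
    (hle : ∀ u : ℝ, 1 ≤ |u| → m u ≤ C₁ * Real.exp (C₂ * |u|)) :
    IntegrableOn (fun u => Real.exp (-a * u ^ 2) * √(m u)) (Set.Icc (-1) 1)ᶜ := by
  have hexp (u : ℝ) : Real.exp (-a * u ^ 2) * Real.exp (C₂ * |u| / 2) ≤
      Real.exp (C₂ ^ 2 / (8 * a)) * Real.exp (-(a / 2) * u ^ 2) := by
    have hsq : C₂ ^ 2 / (8 * a) + -(a / 2) * u ^ 2 - (-a * u ^ 2 + C₂ * |u| / 2) =
        (C₂ - 2 * a * |u|) ^ 2 / (8 * a) := by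
      rw [← sq_abs u]
      field_simp
      ring
    rw [← Real.exp_add, ← Real.exp_add, Real.exp_le_exp, ← sub_nonneg, hsq]
    positivity
  refine ((((integrable_exp_neg_mul_sq (half_pos ha)).const_mul
    (Real.exp (C₂ ^ 2 / (8 * a)))).const_mul √C₁).integrableOn).mono'
    (Measurable.aestronglyMeasurable (by fun_prop))
    ((ae_restrict_mem measurableSet_Icc.compl).mono fun u hu => ?_)
  have hu₁ : 1 ≤ |u| := (not_le.1 (mt abs_le.1 hu)).le
  rw [Real.norm_of_nonneg (by positivity)]
  calc Real.exp (-a * u ^ 2) * √(m u)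
      ≤ Real.exp (-a * u ^ 2) * √(C₁ * Real.exp (C₂ * |u|)) := by
        gcongr
        exact hle u hu₁
    _ = √C₁ * (Real.exp (-a * u ^ 2) * Real.exp (C₂ * |u| / 2)) := by
        rw [Real.sqrt_mul' _ (Real.exp_pos _).le, ← Real.exp_half, mul_left_comm]
    _ ≤ √C₁ * (Real.exp (C₂ ^ 2 / (8 * a)) * Real.exp (-(a / 2) * u ^ 2)) :=
        mul_le_mul_of_nonneg_left (hexp u) (Real.sqrt_nonneg _)

theorem integrable_exp_mul_sqrt {b K C₁ C₂ : ℝ} (hb : b < 2) (ha : 0 < a) (hm : Measurable m)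
    (hsmall : ∀ u : ℝ, u ≠ 0 → |u| ≤ 1 → m u ≤ K * |u| ^ (-b))
    (hlarge : ∀ u : ℝ, 1 ≤ |u| → m u ≤ C₁ * Real.exp (C₂ * |u|)) :
    Integrable fun u => Real.exp (-a * u ^ 2) * √(m u) := by
  have hexp (u : ℝ) : ‖Real.exp (-a * u ^ 2)‖ ≤ 1 := by
    rw [Real.norm_of_nonneg (Real.exp_pos _).le, Real.exp_le_one_iff, neg_mul]
    exact neg_nonpos.2 (by positivity)
  rw [← integrableOn_univ, ← Set.union_compl_self (Set.Icc (-1 : ℝ) 1)]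
  exact IntegrableOn.union ((integrableOn_sqrt_of_le_rpow hb hm hsmall).bdd_mul
    (by fun_prop) (ae_of_all _ hexp)) (integrableOn_exp_mul_sqrt_of_le_exp ha hm hlarge)

end Density

end FreeNoise

end

open FreeNoise in
theorem theorem8p4_general (m : ℝ → ℝ) (hm0 : ∀ u, 0 ≤ m u) {a : ℝ} (ha : a < 1 / 2)
    (hint : Integrable fun u => Real.exp (-a * u ^ 2) * √(m u)) :
    (∀ t n, Integrable (tmDensity m t n)) ∧
    (∀ t, ∃ p : ℕ, tmIndicator m t ∈ K (-(p : ℤ))) ∧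
    (Integrable (fun u : ℝ => m u / (1 + u ^ 2)) →
      ∀ t, ∃ f g : Lp ℂ 2 (volume : Measure ℝ), f =ᵐ[volume] indicatorTo t ∧
        IsTm m f g ∧ ∀ n, tmIndicator m t n = ∫ x : ℝ, conj (hermiteFun n x) * g x) ∧
    ∃ X W : ℝ → (G1 →L[ℂ] Gm1),
      (∀ t f, (X t f).coeff = freeField (tmIndicator m t) f.coeff) ∧
      ∀ t f, Tendsto (fun h : ℝ => (h : ℂ)⁻¹ • (X (t + h) f - X t f)) (𝓝[≠] 0)
        (𝓝 (W t f)) := by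
  have hΨ (t : ℝ) := integrable_exp_smul_sqrt_mul hint
    (continuous_ft (integrable_indicatorTo t)) (norm_ft_indicatorTo_le t)
  have hΨ' (t : ℝ) := integrable_exp_smul_sqrt_mul hint
    (F := fun u => Complex.exp (-(Complex.I * u * t))) (by fun_prop)
    (fun u => (norm_exp_neg_I_mul u t).le)
  have hm : AEStronglyMeasurable fun u => (√(m u) : ℂ) :=
    aestronglyMeasurable_of_integrable_exp_smul (a := a) (by simpa using hint.ofReal (𝕜 := ℂ))
  refine ⟨fun t => integrable_mul_conj_ft_hermiteFun ha (hΨ t), fun t => ?_, fun hm₁ t => ?_,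
    exists_hasDeriv_field ha hΨ hΨ' fun t => ?_⟩
  · obtain ⟨p, hp⟩ := exists_norm_toLp_hermiteCoeff_le ha
    exact ⟨p, (hp _ (hΨ t)).1⟩
  · obtain ⟨g, hg⟩ := exists_isTm (integrable_indicatorTo t) (memLp_indicatorTo t 2)
      (memLp_sqrt_mul_ft_indicatorTo hm hm0 hm₁ t)
    exact ⟨_, g, MemLp.coeFn_toLp _, hg⟩
  · refine (tendsto_integral_slope_ft_indicatorTo (hint.ofReal (𝕜 := ℂ)) t).congr fun s =>
      integral_congr_ae (ae_of_all _ fun u => congrArg norm ?_)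
    rw [Complex.real_smul, RCLike.ofReal_mul]
    simp only [Complex.coe_algebraMap]
    ring

theorem theorem8p4 (m : ℝ → ℝ) (hm : Measurable m) (hm0 : ∀ u, 0 ≤ m u)
    (b K C₁ C₂ : ℝ) (hb : b < 2) (hC₁ : 0 < C₁) (hC₂ : 0 < C₂)
    (hsmall : ∀ t : ℝ, t ≠ 0 → |t| ≤ 1 → m t ≤ K * |t| ^ (-b))
    (hlarge : ∀ t : ℝ, 1 ≤ |t| → m t ≤ C₁ * Real.exp (C₂ * |t|)) :
    -- `T_m 1_{[0,t]}` is well defined, and belongs to `K_{-p}` for some `p`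
    (∀ t n, Integrable (FreeNoise.tmDensity m t n)) ∧
    (∀ t, ∃ p : ℕ, FreeNoise.tmIndicator m t ∈ FreeNoise.K (-(p : ℤ))) ∧
    -- it is the value of the operator `T_m` of `L²(ℝ)` at `1_{[0,t]}` if `∫ m(u)/(1+u²) du < ∞`
    (Integrable (fun u : ℝ => m u / (1 + u ^ 2)) →
      ∀ t, ∃ f g : Lp ℂ 2 (volume : Measure ℝ), f =ᵐ[volume] FreeNoise.indicatorTo t ∧
        FreeNoise.IsTm m f g ∧
        ∀ n, FreeNoise.tmIndicator m t n = ∫ x : ℝ, conj (FreeNoise.hermiteFun n x) * g x) ∧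
    -- the process `X_m` and its derivative `W_m`
    ∃ X W : ℝ → (FreeNoise.G1 →L[ℂ] FreeNoise.Gm1),
      (∀ t f, (X t f).coeff = FreeNoise.freeField (FreeNoise.tmIndicator m t) f.coeff) ∧
      ∀ t f, Tendsto (fun h : ℝ => (h : ℂ)⁻¹ • (X (t + h) f - X t f)) (𝓝[≠] 0) (𝓝 (W t f)) :=
  theorem8p4_general m hm0 (by norm_num : (1 / 4 : ℝ) < 1 / 2)
    (FreeNoise.integrable_exp_mul_sqrt hb (by norm_num) hm hsmall hlarge)
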